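/- **Theorem 1.4.** Let $n\ge 3$, $m\ge 1$, let $\varepsilon_1,\dots,\varepsilon_n\in\{1,-1\}$, and let $(\mathbb R^n,g)$ be the pseudo-Euclidean space with coordinates $x=(x_1,\dots,x_n)$ and $g_{ij}=\delta_{ij}\varepsilon_i$. Let $(F^m,g_F)$ be a non-empty $m$-dimensional semi-Riemannian Einstein manifold, $\mathrm{Ric}_{g_F}=\lambda_F\,g_F$ with $\lambda_F$ constant. Let $\alpha_1,\dots,\alpha_n\in\mathbb R$ with $\varepsilon_{i_0}:=\sum_{i=1}^n\varepsilon_i\alpha_i^2\neq 0$, and put $\xi=\sum_{i=1}^n\alpha_i x_i$. Let $\varphi,f,h:\mathbb R\to\mathbb R$ be smooth functions with $\varphi$ nowhere zero and $f>0$, regarded as functions $\varphi(\xi),f(\xi),h(\xi)$ on $\mathbb R^n$. On $M=\mathbb R^n\times F$ consider the warped product metric $$\tilde g=\bar g+f^2 g_F,\qquad \bar g=\frac1{\varphi^2}\,g .$$ Then, for every smooth $\rho=\rho(\xi)$, $(M,\tilde g)$ is a gradient Ricci almost soliton with potential function $h$ and soliton function $\rho$, that is, $$\mathrm{Ric}_{\tilde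 g}+\mathrm{Hess}_{\tilde g}(h)=\rho\,\tilde g ,$$ if and only if the following system holds on $\mathbb R$ (primes denote derivatives with respect to $\xi$): $$\begin{cases} f\big[(n-2)\varphi''+2\varphi'h'+\varphi h''\big]-m\varphi f''-2m\varphi'f'=0,\\[4pt] \varepsilon_{i_0}\big[f\varphi\varphi''-(n-1)f(\varphi')^2+m\varphi\varphi'f'-f\varphi\varphi'h'\big]=\rho f,\\[4pt] \varepsilon_{i_0}\big[-f\varphi^2f''+(n-2)f\varphi f'\varphi'-(m-1)\varphi^2(f')^2+f\varphi^2f'h'\big]=\rho f^2-\lambda_F . \end{cases}$$ Moreover, $(M,\tilde g)$ is a gradient Ricci almost soliton with potential $h$ for some smooth function $\rho$ on $M$ if and only if there is a smooth function $\rho:\mathbb R\to\mathbb R$ such that $\varphi,f,h,\rho$ satisfy this system. -/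

import Mathlib

open scoped Manifold ContDiff

set_option maxSynthPendingDepth 3

noncomputable section

/-! ### Local differential geometry of a metric on a finite-dimensional vector space

`G x` is the bilinear form of the metric at `x`, written in linear coordinates. -/

section Coordinates

variable {E : Type*} [NormedAddCommGroup E] [NormedSpace ℝ E]

/-- Christoffel symbols of the first kind:
`(u, v, w) ↦ ½ (∂_u G(v, w) + ∂_v G(u, w) - ∂_w G(u, v))`. -/
def christoffelFirst (G : E → E →L[ℝ] E →L[ℝ] ℝ) (x : E) : E →L[ℝ] E →L[ℝ] E →L[ℝ] ℝ :=
  (1 / 2 : ℝ) • (fderiv ℝ G x + (fderiv ℝ G x).flip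
    - ((ContinuousLinearMap.flipₗᵢ ℝ E E ℝ).toContinuousLinearEquiv :
        (E →L[ℝ] E →L[ℝ] ℝ) →L[ℝ] (E →L[ℝ] E →L[ℝ] ℝ)).comp (fderiv ℝ G x).flip)

/-- Christoffel symbols of the second kind of the Levi-Civita connection: `Γ(u, v)` is the vector
with `G(Γ(u, v), w) = christoffelFirst G x u v w` for all `w`. -/
def christoffel (G : E → E →L[ℝ] E →L[ℝ] ℝ) (x : E) : E →L[ℝ] E →L[ℝ] E :=
  (ContinuousLinearMap.compL ℝ E (E →L[ℝ] ℝ) E (G x).inverse) ∘L christoffelFirst G x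

/-- The endomorphism `u ↦ R(u, v) w`, where
`R(u, v) w = (∂_u Γ)(v, w) - (∂_v Γ)(u, w) + Γ(u, Γ(v, w)) - Γ(v, Γ(u, w))`. -/
def curvatureEnd (G : E → E →L[ℝ] E →L[ℝ] ℝ) (x : E) (v w : E) : E →L[ℝ] E :=
  ((fderiv ℝ (christoffel G) x).flip v).flip w
    - (fderiv ℝ (christoffel G) x v).flip w
    + (christoffel G x).flip (christoffel G x v w)
    - (christoffel G x v) ∘L ((christoffel G x).flip w)

/-- The Ricci tensor `Ric(v, w) = tr (u ↦ R(u, v) w)`. -/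
def ricciCoord (G : E → E →L[ℝ] E →L[ℝ] ℝ) (x : E) (v w : E) : ℝ :=
  LinearMap.trace ℝ E (curvatureEnd G x v w).toLinearMap

/-- The Hessian `(v, w) ↦ ∂_v ∂_w h - dh(Γ(v, w))`. -/
def hessianCoord (G : E → E →L[ℝ] E →L[ℝ] ℝ) (h : E → ℝ) (x : E) (v w : E) : ℝ :=
  fderiv ℝ (fderiv ℝ h) x v w - fderiv ℝ h x (christoffel G x v w)

end Coordinates

/-! ### Semi-Riemannian metrics on manifolds -/

section Manifolds

variable {E : Type*} [NormedAddCommGroup E] [NormedSpace ℝ E]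
  {H : Type*} [TopologicalSpace H] (I : ModelWithCorners ℝ E H)
  {M : Type*} [TopologicalSpace M] [ChartedSpace H M]
  {E' : Type*} [NormedAddCommGroup E'] [NormedSpace ℝ E']
  {H' : Type*} [TopologicalSpace H'] (J : ModelWithCorners ℝ E' H')
  {N : Type*} [TopologicalSpace N] [ChartedSpace H' N]

variable (M) in
/-- A field of bilinear forms on the tangent spaces of `M`. -/
abbrev BilinField : Type _ :=
  ∀ p : M, TangentSpace I p →L[ℝ] TangentSpace I p →L[ℝ] ℝ

/-- The pullback `(Ψ^* g)_p (v, w) = g_{Ψ p} (dΨ_p v, dΨ_p w)`. -/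
def pullbackField (Ψ : M → N) (g : BilinField J N) : BilinField I M := fun p =>
  (ContinuousLinearMap.precomp ℝ (mfderiv I J Ψ p)) ∘L (g (Ψ p) ∘L mfderiv I J Ψ p)

variable {I}

/-- The expression of `g` in the chart of `M` around `p`, that is, its pullback by the inverse of
the chart. It is meaningful on `(extChartAt I p).target`. -/
def chartMetric (g : BilinField I M) (p : M) : E → E →L[ℝ] E →L[ℝ] ℝ :=
  pullbackField 𝓘(ℝ, E) I (extChartAt I p).symm g

/-- A semi-Riemannian metric on a smooth manifold: a field of symmetric nondegenerate bilinear
forms, whose coefficients in charts are smooth. -/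
structure IsSemiRiemannianMetric (g : BilinField I M) : Prop where
  symm : ∀ p v w, g p v w = g p w v
  nondegenerate : ∀ p v, (∀ w, g p v w = 0) → v = 0
  smooth : ∀ p : M, ContDiffOn ℝ ∞ (chartMetric g p) (extChartAt I p).target

/-- The Ricci tensor of `g` at `p`, computed in the chart around `p` (in which Mathlib identifies
the tangent space at `p` with the model vector space `E`). -/
def ricci (g : BilinField I M) (p : M) (v w : TangentSpace I p) : ℝ :=
  ricciCoord (E := E) (chartMetric g p) (extChartAt I p p) v w

/-- The Hessian of the function `h` with respect to `g` at `p`, computed in the chart around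
`p`. -/
def hessian (g : BilinField I M) (h : M → ℝ) (p : M) (v w : TangentSpace I p) : ℝ :=
  hessianCoord (E := E) (chartMetric g p) (h ∘ (extChartAt I p).symm) (extChartAt I p p) v w

/-- `g` is a semi-Riemannian Einstein metric with `Ric = c g`, `c` constant. -/
structure IsEinsteinMetric (g : BilinField I M) (c : ℝ) : Prop where
  isSemiRiemannianMetric : IsSemiRiemannianMetric g
  ricci_eq : ∀ p v w, ricci g p v w = c * g p v w

/-- `(M, g)` is a gradient Ricci almost soliton with potential `h` and soliton function `ρ`:
`Ric + Hess h = ρ g`, with `g`, `h` and `ρ` smooth. -/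
structure IsGradientRicciAlmostSoliton (g : BilinField I M) (h ρ : M → ℝ) : Prop where
  isSemiRiemannianMetric : IsSemiRiemannianMetric g
  smooth_potential : ContMDiff I 𝓘(ℝ, ℝ) ∞ h
  smooth_function : ContMDiff I 𝓘(ℝ, ℝ) ∞ ρ
  soliton_eq : ∀ p v w, ricci g p v w + hessian g h p v w = ρ p * g p v w

variable {J}

/-- The warped product metric `π_M^* g_B + (f ∘ π_M)² π_N^* g_F` on `M × N`. -/
def warpedMetric (gB : BilinField I M) (f : M → ℝ) (gF : BilinField J N) :
    BilinField (I.prod J) (M × N) := fun p =>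
  pullbackField (I.prod J) I Prod.fst gB p
    + (f p.1) ^ 2 • pullbackField (I.prod J) J Prod.snd gF p

end Manifolds

/-! ### Conformally pseudo-Euclidean metrics -/

/-- The bilinear form `(v, w) ↦ ∑ i, ε i * v_i * w_i` on `ℝⁿ`. -/
def pseudoEuclideanForm {n : ℕ} (ε : Fin n → ℝ) :
    EuclideanSpace ℝ (Fin n) →L[ℝ] EuclideanSpace ℝ (Fin n) →L[ℝ] ℝ :=
  ∑ i, ε i • (EuclideanSpace.proj i : EuclideanSpace ℝ (Fin n) →L[ℝ] ℝ).smulRight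
    (EuclideanSpace.proj i : EuclideanSpace ℝ (Fin n) →L[ℝ] ℝ)

/-- The metric `φ⁻² ∑ i, ε i dx_i²` on `ℝⁿ`. -/
def conformalPseudoEuclidean {n : ℕ} (ε : Fin n → ℝ) (φ : EuclideanSpace ℝ (Fin n) → ℝ) :
    BilinField (𝓡 n) (EuclideanSpace ℝ (Fin n)) := fun x =>
  ((1 / φ x ^ 2) • pseudoEuclideanForm ε :
    EuclideanSpace ℝ (Fin n) →L[ℝ] EuclideanSpace ℝ (Fin n) →L[ℝ] ℝ)

/-- The function `x ↦ u (∑ i, α i x_i)` on `ℝⁿ`. -/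
def ofXi {n : ℕ} (α : Fin n → ℝ) (u : ℝ → ℝ) : EuclideanSpace ℝ (Fin n) → ℝ :=
  fun x => u (∑ i, α i * x i)

/-- The system of three ordinary differential equations for `φ`, `f`, `h` and `ρ`. -/
def SolitonSystem (n m : ℕ) (e c : ℝ) (φ f h ρ : ℝ → ℝ) : Prop :=
  ∀ t : ℝ,
    f t * (((n : ℝ) - 2) * deriv (deriv φ) t + 2 * deriv φ t * deriv h t + φ t * deriv (deriv h) t)
        - m * φ t * deriv (deriv f) t - 2 * m * deriv φ t * deriv f t = 0 ∧
    e * (f t * φ t * deriv (deriv φ) t - ((n : ℝ) - 1) * f t * (deriv φ t) ^ 2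
        + m * φ t * deriv φ t * deriv f t - f t * φ t * deriv φ t * deriv h t) = ρ t * f t ∧
    e * (-(f t * φ t ^ 2 * deriv (deriv f) t) + ((n : ℝ) - 2) * f t * φ t * deriv f t * deriv φ t
        - ((m : ℝ) - 1) * φ t ^ 2 * (deriv f t) ^ 2 + f t * φ t ^ 2 * deriv f t * deriv h t)
      = ρ t * f t ^ 2 - c

end

noncomputable section

/-! ### Christoffel symbols of a nondegenerate metric in coordinates. -/

section MetricGeneral

variable {E : Type*} [NormedAddCommGroup E] [NormedSpace ℝ E]

/-! In the product of the identity of ℝⁿ with a chart of `F`, the metric is `φ(a x)⁻² B + f(a x)²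
K(y)`, where `B` is constant and `a` is the linear functional ξ. Let `s` be the `B`-gradient of `a`,
so that `a s` is ε_{i₀}. The base coefficients vary only along `a`, hence the Christoffel symbols,
the Ricci tensor and the Hessian of h(ξ) are explicit in `p = φ'/φ`, `q = f'/f` and `r = f f' φ²`
(`christoffel_eq`, `ricciCoord_eq`, `hessianCoord_eq`). As the fibre is Einstein, the soliton
equation at a point becomes `A₁ a⊗a + A₂ B + A₃ K = 0`, with coefficients depending only on t = ξ(x)
and on the value of the soliton function there (`ricci_add_hessian_warpedMetric`).

These three tensors are linearly independent (`coefficients_eq_zero`), so all `Aᵢ` vanish; up to the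
nonzero factors `φ f`, `φ² f` and 1 this is the system at t (`system_iff_coefficients`). Every t
occurs because ξ is onto and `F` is non-empty. Since `f` has no zeros, the second equation can be
solved for ρ: over t, any soliton function takes the value at t of one fixed smooth function on ℝ,
which gives the last assertion. -/

lemma christoffelFirst_apply (G : E → E →L[ℝ] E →L[ℝ] ℝ) (x u v w : E) :
    christoffelFirst G x u v w =
      (1 / 2 : ℝ) * (fderiv ℝ G x u v w + fderiv ℝ G x v u w - fderiv ℝ G x w u v) := by
  simp [christoffelFirst]

lemma christoffel_apply (G : E → E →L[ℝ] E →L[ℝ] ℝ) (x u v : E) :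
    christoffel G x u v = (G x).inverse (christoffelFirst G x u v) := by
  simp [christoffel]

lemma curvatureEnd_apply (G : E → E →L[ℝ] E →L[ℝ] ℝ) (x u v w : E) :
    curvatureEnd G x v w u = fderiv ℝ (christoffel G) x u v w - fderiv ℝ (christoffel G) x v u w
      + christoffel G x u (christoffel G x v w) - christoffel G x v (christoffel G x u w) := by
  simp [curvatureEnd]

lemma fderiv_apply_apply {F₁ F₂ : Type*} [NormedAddCommGroup F₁] [NormedSpace ℝ F₁]
    [NormedAddCommGroup F₂] [NormedSpace ℝ F₂] {G : E → F₁ →L[ℝ] F₁ →L[ℝ] F₂} {x : E}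
    (hG : DifferentiableAt ℝ G x) (u : E) (v w : F₁) :
    fderiv ℝ (fun y => G y v w) x u = fderiv ℝ G x u v w := by
  rw [fderiv_clm_apply (hG.clm_apply (differentiableAt_const v)) (differentiableAt_const w),
    fderiv_clm_apply hG (differentiableAt_const v)]
  simp

/-- Curvature and Hessian depend only on the germ of the metric. This matters because the chart
expression has the warped form only over the target of the fibre chart. -/
lemma christoffel_congr {G G' : E → E →L[ℝ] E →L[ℝ] ℝ} {x : E} (hG : G =ᶠ[nhds x] G') :
    christoffel G =ᶠ[nhds x] christoffel G' := by
  filter_upwards [hG.eventuallyEq_nhds] with y hy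
  simp only [christoffel, christoffelFirst, hy.fderiv_eq, hy.eq_of_nhds]

lemma ricciCoord_congr {G G' : E → E →L[ℝ] E →L[ℝ] ℝ} {x : E} (hG : G =ᶠ[nhds x] G')
    (v w : E) : ricciCoord G x v w = ricciCoord G' x v w := by
  have h := christoffel_congr hG
  simp only [ricciCoord, curvatureEnd, h.fderiv_eq, h.eq_of_nhds]

lemma hessianCoord_congr {G G' : E → E →L[ℝ] E →L[ℝ] ℝ} {x : E} (hG : G =ᶠ[nhds x] G')
    (h : E → ℝ) (v w : E) : hessianCoord G h x v w = hessianCoord G' h x v w := by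
  simp only [hessianCoord, (christoffel_congr hG).eq_of_nhds]

/-- The connection is torsion-free. Symmetry is needed near `x`, not only at `x`, because the term
`∂_w G(u, v)` must be symmetric too. -/
lemma christoffel_comm {G : E → E →L[ℝ] E →L[ℝ] ℝ} {x : E}
    (hG : DifferentiableAt ℝ G x) (hsymm : ∀ᶠ y in nhds x, ∀ v w, G y v w = G y w v) (u v : E) :
    christoffel G x u v = christoffel G x v u := by
  rw [christoffel_apply, christoffel_apply]
  congr 1
  ext w
  have h : fderiv ℝ G x w u v = fderiv ℝ G x w v u := by
    rw [← fderiv_apply_apply hG, ← fderiv_apply_apply hG]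
    have : (fun y => G y u v) =ᶠ[nhds x] fun y => G y v u := hsymm.mono fun y hy => hy u v
    rw [this.fderiv_eq]
  rw [christoffelFirst_apply, christoffelFirst_apply, h]
  ring

variable [FiniteDimensional ℝ E]

/-- An injective map from `E` to its dual is bijective by dimension. This rules out the default
value 0 of `inverse` in the definition of `christoffel`. -/
lemma isInvertible_of_nondegenerate {b : E →L[ℝ] E →L[ℝ] ℝ}
    (hb : ∀ v, (∀ w, b v w = 0) → v = 0) : b.IsInvertible := by
  have hinj : Function.Injective b := by
    rw [injective_iff_map_eq_zero]
    intro v hv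
    exact hb v fun w => by simp [hv]
  have hdim : Module.finrank ℝ E = Module.finrank ℝ (E →L[ℝ] ℝ) := by
    rw [← (LinearMap.toContinuousLinearMap (𝕜 := ℝ) (E := E) (F' := ℝ)).finrank_eq]
    exact (Subspace.dual_finrank_eq (K := ℝ) (V := E)).symm
  refine ⟨(LinearEquiv.ofInjectiveOfFinrankEq b.toLinearMap hinj hdim).toContinuousLinearEquiv, ?_⟩
  ext v w
  rfl

lemma christoffel_eq_of_forall {G : E → E →L[ℝ] E →L[ℝ] ℝ} {x u v z : E}
    (hb : ∀ v, (∀ w, G x v w = 0) → v = 0)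
    (h : ∀ w, G x z w = christoffelFirst G x u v w) : christoffel G x u v = z := by
  rw [christoffel_apply, (isInvertible_of_nondegenerate hb).inverse_apply_eq]
  ext w
  exact (h w).symm

lemma metric_christoffel {G : E → E →L[ℝ] E →L[ℝ] ℝ} {x : E}
    (hb : ∀ v, (∀ w, G x v w = 0) → v = 0) (u v w : E) :
    G x (christoffel G x u v) w = christoffelFirst G x u v w := by
  have := ((isInvertible_of_nondegenerate hb).inverse_apply_eq (y := christoffelFirst G x u v)
    (x := christoffel G x u v)).1 (christoffel_apply G x u v).symm
  rw [← this]

lemma differentiableAt_christoffel {G : E → E →L[ℝ] E →L[ℝ] ℝ} {x : E}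
    (hG : ContDiffAt ℝ ∞ G x) (hb : ∀ v, (∀ w, G x v w = 0) → v = 0) :
    DifferentiableAt ℝ (christoffel G) x := by
  have h1 : DifferentiableAt ℝ (fderiv ℝ G) x :=
    (hG.fderiv_right (m := 1) (by norm_cast)).differentiableAt (by simp)
  have h2 : DifferentiableAt ℝ (fun y => (G y).inverse) x :=
    ((isInvertible_of_nondegenerate hb).contDiffAt_map_inverse (n := 1)).differentiableAt (by simp)
      |>.comp x (hG.differentiableAt (by simp))
  have h3 : DifferentiableAt ℝ (christoffelFirst G) x := by
    have h4 : DifferentiableAt ℝ (fun y => (fderiv ℝ G y).flip) x :=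
      (ContinuousLinearMap.flipₗᵢ ℝ E E (E →L[ℝ] ℝ)).toContinuousLinearEquiv.differentiableAt.comp
        x h1
    exact ((h1.add h4).sub ((differentiableAt_const _).clm_comp h4)).const_smul (1 / 2 : ℝ)
  exact ((ContinuousLinearMap.compL ℝ E (E →L[ℝ] ℝ) E).differentiableAt.comp x h2).clm_comp h3

end MetricGeneral

/-! ### Christoffel symbols of a warped product in coordinates. -/

section WarpedCoordinates

variable {V W : Type*} [NormedAddCommGroup V] [NormedSpace ℝ V]
  [NormedAddCommGroup W] [NormedSpace ℝ W]

/-- The pullback of bilinear forms along a continuous linear map, as a continuous linear map. -/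
def bilinPull (L : V →L[ℝ] W) : (W →L[ℝ] W →L[ℝ] ℝ) →L[ℝ] (V →L[ℝ] V →L[ℝ] ℝ) :=
  (ContinuousLinearMap.compL ℝ V (W →L[ℝ] ℝ) (V →L[ℝ] ℝ) (ContinuousLinearMap.precomp ℝ L)) ∘L
    ContinuousLinearMap.precomp (W →L[ℝ] ℝ) L

@[simp]
lemma bilinPull_apply (L : V →L[ℝ] W) (b : W →L[ℝ] W →L[ℝ] ℝ) (v v' : V) :
    bilinPull L b v v' = b (L v) (L v') := rfl

/-- The warped product metric `φ(a x)⁻² B + f(a x)² K(y)` on `V × W`, where `a` is a linear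
functional on `V`. -/
def warpedCoord (B : V →L[ℝ] V →L[ℝ] ℝ) (a : V →L[ℝ] ℝ) (φ f : ℝ → ℝ)
    (K : W → W →L[ℝ] W →L[ℝ] ℝ) (z : V × W) : (V × W) →L[ℝ] (V × W) →L[ℝ] ℝ :=
  (1 / φ (a z.1) ^ 2) • bilinPull (ContinuousLinearMap.fst ℝ V W) B
    + (f (a z.1) ^ 2) • bilinPull (ContinuousLinearMap.snd ℝ V W) (K z.2)

@[simp]
lemma warpedCoord_apply (B : V →L[ℝ] V →L[ℝ] ℝ) (a : V →L[ℝ] ℝ) (φ f : ℝ → ℝ)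
    (K : W → W →L[ℝ] W →L[ℝ] ℝ) (z X Y : V × W) :
    warpedCoord B a φ f K z X Y =
      1 / φ (a z.1) ^ 2 * B X.1 Y.1 + f (a z.1) ^ 2 * K z.2 X.2 Y.2 := by
  simp [warpedCoord]

/-- Standing assumptions for the warped product metric `warpedCoord B a φ f K` over the open set
`U`: here `s` is the `B`-gradient of `a`, and `p`, `q`, `r` are the functions `φ' / φ`, `f' / f`
and `f f' φ²`. -/
structure IsWarpedCoord (B : V →L[ℝ] V →L[ℝ] ℝ) (a : V →L[ℝ] ℝ) (s : V) (φ f p q r : ℝ → ℝ)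
    (K : W → W →L[ℝ] W →L[ℝ] ℝ) (U : Set W) : Prop where
  symm_base : ∀ v w, B v w = B w v
  nondegenerate_base : ∀ v, (∀ w, B v w = 0) → v = 0
  grad : ∀ v, B s v = a v
  smooth_conformal : ContDiff ℝ ∞ φ
  conformal_ne : ∀ t, φ t ≠ 0
  smooth_warping : ContDiff ℝ ∞ f
  warping_ne : ∀ t, f t ≠ 0
  deriv_conformal : ∀ t, deriv φ t = p t * φ t
  deriv_warping : ∀ t, deriv f t = q t * f t
  eq_mul : ∀ t, r t = f t ^ 2 * q t * φ t ^ 2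
  isOpen : IsOpen U
  smooth_fiber : ContDiffOn ℝ ∞ K U
  symm_fiber : ∀ y ∈ U, ∀ v w, K y v w = K y w v
  nondegenerate_fiber : ∀ y ∈ U, ∀ v, (∀ w, K y v w = 0) → v = 0

variable {B : V →L[ℝ] V →L[ℝ] ℝ} {a : V →L[ℝ] ℝ} {s : V} {φ f p q r : ℝ → ℝ}
    {K : W → W →L[ℝ] W →L[ℝ] ℝ} {U : Set W}

namespace IsWarpedCoord

lemma differentiable_p (H : IsWarpedCoord B a s φ f p q r K U) : Differentiable ℝ p := by
  have h : p = fun t => deriv φ t / φ t := by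
    ext t
    rw [H.deriv_conformal, mul_div_cancel_right₀ _ (H.conformal_ne t)]
  rw [h]
  exact ((contDiff_infty_iff_deriv.1 H.smooth_conformal).2.differentiable (by simp)).fun_div
    (H.smooth_conformal.differentiable (by simp)) H.conformal_ne

lemma differentiable_q (H : IsWarpedCoord B a s φ f p q r K U) : Differentiable ℝ q := by
  have h : q = fun t => deriv f t / f t := by
    ext t
    rw [H.deriv_warping, mul_div_cancel_right₀ _ (H.warping_ne t)]
  rw [h]
  exact ((contDiff_infty_iff_deriv.1 H.smooth_warping).2.differentiable (by simp)).fun_div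
    (H.smooth_warping.differentiable (by simp)) H.warping_ne

lemma differentiable_r (H : IsWarpedCoord B a s φ f p q r K U) : Differentiable ℝ r := by
  rw [funext H.eq_mul]
  have h1 := H.smooth_conformal.differentiable (by simp)
  have h2 := H.smooth_warping.differentiable (by simp)
  have h3 := H.differentiable_q
  fun_prop

lemma contDiffAt_fiber (H : IsWarpedCoord B a s φ f p q r K U) {y : W} (hy : y ∈ U) :
    ContDiffAt ℝ ∞ K y :=
  H.smooth_fiber.contDiffAt (H.isOpen.mem_nhds hy)

lemma contDiffAt (H : IsWarpedCoord B a s φ f p q r K U) {z : V × W} (hz : z.2 ∈ U) :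
    ContDiffAt ℝ ∞ (warpedCoord B a φ f K) z := by
  have hφ := H.smooth_conformal
  have hf := H.smooth_warping
  have hK : ContDiffAt ℝ ∞ (fun z : V × W => K z.2) z :=
    (H.contDiffAt_fiber hz).comp z contDiffAt_snd
  have hK' : ContDiffAt ℝ ∞
      (fun z : V × W => bilinPull (ContinuousLinearMap.snd ℝ V W) (K z.2)) z :=
    (bilinPull (ContinuousLinearMap.snd ℝ V W)).contDiff.contDiffAt.comp z hK
  have h1 : ContDiffAt ℝ ∞ (fun z : V × W => 1 / φ (a z.1) ^ 2) z :=
    contDiffAt_const.div (by fun_prop) (pow_ne_zero _ (H.conformal_ne _))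
  have h2 : ContDiffAt ℝ ∞ (fun z : V × W => f (a z.1) ^ 2) z := by fun_prop
  exact (h1.smul contDiffAt_const).add (h2.smul hK')

lemma nondegenerate (H : IsWarpedCoord B a s φ f p q r K U) {z : V × W} (hz : z.2 ∈ U)
    (X : V × W) (hX : ∀ Y, warpedCoord B a φ f K z X Y = 0) : X = 0 := by
  refine Prod.ext (H.nondegenerate_base _ fun v => ?_) (H.nondegenerate_fiber _ hz _ fun w => ?_)
  · simpa [H.conformal_ne] using hX (v, 0)
  · simpa [H.warping_ne] using hX (0, w)

end IsWarpedCoord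

/-- All coefficients to be differentiated are sums of products `g(a x) k(y)`, so this Leibniz rule
serves both the metric and its Christoffel symbols. -/
lemma hasFDerivAt_smul_fiber {Z : Type*} [NormedAddCommGroup Z] [NormedSpace ℝ Z] {a : V →L[ℝ] ℝ}
    {g : ℝ → ℝ} {k : W → Z} {z : V × W} (hg : DifferentiableAt ℝ g (a z.1))
    (hk : DifferentiableAt ℝ k z.2) :
    HasFDerivAt (fun z : V × W => g (a z.1) • k z.2)
      (g (a z.1) • (fderiv ℝ k z.2 ∘L ContinuousLinearMap.snd ℝ V W)
        + (deriv g (a z.1) • (a ∘L ContinuousLinearMap.fst ℝ V W)).smulRight (k z.2)) z :=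
  (hg.hasDerivAt.comp_hasFDerivAt z (a ∘L ContinuousLinearMap.fst ℝ V W).hasFDerivAt).smul
    (hk.hasFDerivAt.comp z hasFDerivAt_snd)

lemma fderiv_smul_fiber {Z : Type*} [NormedAddCommGroup Z] [NormedSpace ℝ Z] {a : V →L[ℝ] ℝ}
    {g : ℝ → ℝ} {k : W → Z} {z : V × W} (hg : DifferentiableAt ℝ g (a z.1))
    (hk : DifferentiableAt ℝ k z.2) (Y : V × W) :
    fderiv ℝ (fun z : V × W => g (a z.1) • k z.2) z Y =
      g (a z.1) • fderiv ℝ k z.2 Y.2 + (deriv g (a z.1) * a Y.1) • k z.2 := by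
  rw [(hasFDerivAt_smul_fiber hg hk).fderiv]
  simp

lemma differentiableAt_smul_fiber {Z : Type*} [NormedAddCommGroup Z] [NormedSpace ℝ Z]
    {a : V →L[ℝ] ℝ} {g : ℝ → ℝ} {k : W → Z} {z : V × W} (hg : DifferentiableAt ℝ g (a z.1))
    (hk : DifferentiableAt ℝ k z.2) :
    DifferentiableAt ℝ (fun z : V × W => g (a z.1) • k z.2) z :=
  (hasFDerivAt_smul_fiber hg hk).differentiableAt

namespace IsWarpedCoord

lemma fderiv_metric (H : IsWarpedCoord B a s φ f p q r K U) {z : V × W} (hz : z.2 ∈ U)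
    (Z X Y : V × W) :
    fderiv ℝ (warpedCoord B a φ f K) z Z X Y =
      -2 * p (a z.1) / φ (a z.1) ^ 2 * a Z.1 * B X.1 Y.1
        + 2 * q (a z.1) * f (a z.1) ^ 2 * a Z.1 * K z.2 X.2 Y.2
        + f (a z.1) ^ 2 * fderiv ℝ K z.2 Z.2 X.2 Y.2 := by
  have hK := (H.contDiffAt_fiber hz).differentiableAt (by simp)
  rw [← fderiv_apply_apply ((H.contDiffAt hz).differentiableAt (by simp)),
    ← fderiv_apply_apply hK]
  have hφ : HasDerivAt φ (p (a z.1) * φ (a z.1)) (a z.1) := by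
    rw [← H.deriv_conformal]
    exact (H.smooth_conformal.differentiable (by simp) _).hasDerivAt
  have hf : HasDerivAt f (q (a z.1) * f (a z.1)) (a z.1) := by
    rw [← H.deriv_warping]
    exact (H.smooth_warping.differentiable (by simp) _).hasDerivAt
  have h1 : HasDerivAt (fun t => 1 / φ t ^ 2) (-2 * p (a z.1) / φ (a z.1) ^ 2) (a z.1) := by
    refine ((hasDerivAt_const (a z.1) (1 : ℝ)).fun_div (hφ.fun_pow 2)
      (pow_ne_zero 2 (H.conformal_ne _))).congr_deriv ?_
    have := H.conformal_ne (a z.1)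
    field_simp
    simp only [Nat.cast_ofNat, Nat.add_one_sub_one, pow_one]
    ring
  have h2 : HasDerivAt (fun t => f t ^ 2) (2 * q (a z.1) * f (a z.1) ^ 2) (a z.1) := by
    refine (hf.fun_pow 2).congr_deriv ?_
    simp
    ring
  have h3 : DifferentiableAt ℝ (fun y => K y X.2 Y.2) z.2 :=
    (hK.clm_apply (differentiableAt_const _)).clm_apply (differentiableAt_const _)
  have h4 : (fun z : V × W => warpedCoord B a φ f K z X Y) = fun z =>
      (fun z : V × W => (1 / φ (a z.1) ^ 2) • (fun _ : W => B X.1 Y.1) z.2) z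
        + (fun z : V × W => (f (a z.1) ^ 2) • (fun y : W => K y X.2 Y.2) z.2) z := by
    ext z
    simp
  rw [h4, fderiv_fun_add
    (differentiableAt_smul_fiber (g := fun t => 1 / φ t ^ 2) h1.differentiableAt
      (differentiableAt_const _))
    (differentiableAt_smul_fiber (g := fun t => f t ^ 2) h2.differentiableAt h3),
    add_apply,
    fderiv_smul_fiber (g := fun t => 1 / φ t ^ 2) h1.differentiableAt (differentiableAt_const _),
    fderiv_smul_fiber (g := fun t => f t ^ 2) h2.differentiableAt h3, h1.deriv, h2.deriv]
  simp
  ring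

variable [FiniteDimensional ℝ V] [FiniteDimensional ℝ W]

/-- The `p`-terms come from the conformal factor and the `q`-terms from differentiating `f²` in
mixed directions. The base metric being `φ⁻² B`, the gradient of `f²/2` is `f f' φ² s = r s`, whence
the term in `r`. The formula is checked by pairing with an arbitrary `Z`. -/
lemma christoffel_eq (H : IsWarpedCoord B a s φ f p q r K U) {z : V × W} (hz : z.2 ∈ U)
    (X Y : V × W) :
    christoffel (warpedCoord B a φ f K) z X Y =
      (-p (a z.1) • (a X.1 • Y.1 + a Y.1 • X.1 - B X.1 Y.1 • s)
          - (r (a z.1) * K z.2 X.2 Y.2) • s,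
        christoffel K z.2 X.2 Y.2 + q (a z.1) • (a X.1 • Y.2 + a Y.1 • X.2)) := by
  refine christoffel_eq_of_forall (H.nondegenerate hz) fun Z => ?_
  have h1 := metric_christoffel (H.nondegenerate_fiber _ hz) X.2 Y.2 Z.2
  have hφ := H.conformal_ne (a z.1)
  rw [christoffelFirst_apply] at h1 ⊢
  rw [H.fderiv_metric hz, H.fderiv_metric hz, H.fderiv_metric hz, warpedCoord_apply]
  simp only [map_add, map_sub, map_smul, add_apply,
    sub_apply, smul_apply, smul_eq_mul, h1, H.grad, H.eq_mul]
  rw [H.symm_base X.1 Z.1, H.symm_base Y.1 Z.1, H.symm_fiber _ hz X.2 Z.2,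
    H.symm_fiber _ hz Y.2 Z.2]
  field_simp
  ring

lemma fderiv_christoffel (H : IsWarpedCoord B a s φ f p q r K U) {z : V × W} (hz : z.2 ∈ U)
    (Z X Y : V × W) :
    fderiv ℝ (christoffel (warpedCoord B a φ f K)) z Z X Y =
      (-(deriv p (a z.1) * a Z.1) • (a X.1 • Y.1 + a Y.1 • X.1 - B X.1 Y.1 • s)
          - (deriv r (a z.1) * a Z.1 * K z.2 X.2 Y.2
            + r (a z.1) * fderiv ℝ K z.2 Z.2 X.2 Y.2) • s,
        fderiv ℝ (christoffel K) z.2 Z.2 X.2 Y.2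
          + (deriv q (a z.1) * a Z.1) • (a X.1 • Y.2 + a Y.1 • X.2)) := by
  have hK := (H.contDiffAt_fiber hz).differentiableAt (by simp)
  have hC := differentiableAt_christoffel (H.contDiffAt_fiber hz) (H.nondegenerate_fiber _ hz)
  rw [← fderiv_apply_apply (differentiableAt_christoffel (H.contDiffAt hz) (H.nondegenerate hz)),
    ← fderiv_apply_apply hC, ← fderiv_apply_apply hK]
  have h3 : DifferentiableAt ℝ (fun y => K y X.2 Y.2 • s) z.2 :=
    ((hK.clm_apply (differentiableAt_const _)).clm_apply (differentiableAt_const _)).smul_const s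
  have h5 : DifferentiableAt ℝ (fun y => christoffel K y X.2 Y.2) z.2 :=
    (hC.clm_apply (differentiableAt_const _)).clm_apply (differentiableAt_const _)
  have h6 : fderiv ℝ (fun y => K y X.2 Y.2 • s) z.2 Z.2 =
      fderiv ℝ (fun y => K y X.2 Y.2) z.2 Z.2 • s := by
    rw [fderiv_smul_const
      ((hK.clm_apply (differentiableAt_const _)).clm_apply (differentiableAt_const _))]
    simp
  -- Constant factors are written as functions so that every summand has the shape required by
  -- `hasFDerivAt_smul_fiber`.
  have hev : (fun z => christoffel (warpedCoord B a φ f K) z X Y) =ᶠ[nhds z] fun z =>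
      (-(p (a z.1) • (fun _ : W => a X.1 • Y.1 + a Y.1 • X.1 - B X.1 Y.1 • s) z.2)
          - r (a z.1) • (fun y : W => K y X.2 Y.2 • s) z.2,
        (fun _ : ℝ => (1 : ℝ)) (a z.1) • (fun y : W => christoffel K y X.2 Y.2) z.2
          + q (a z.1) • (fun _ : W => a X.1 • Y.2 + a Y.1 • X.2) z.2) := by
    filter_upwards [(H.isOpen.preimage continuous_snd).mem_nhds hz] with y hy
    rw [H.christoffel_eq hy]
    simp [mul_smul]
  rw [hev.fderiv_eq, (((hasFDerivAt_smul_fiber (a := a) (H.differentiable_p _)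
      (differentiableAt_const _)).fun_neg.fun_sub
    (hasFDerivAt_smul_fiber (H.differentiable_r _) h3)).prodMk
    ((hasFDerivAt_smul_fiber (a := a) (differentiableAt_const _) h5).fun_add
      (hasFDerivAt_smul_fiber (H.differentiable_q _) (differentiableAt_const _)))).fderiv]
  ext
  · simp only [ContinuousLinearMap.prod_apply, add_apply,
      sub_apply, neg_apply,
      smul_apply, ContinuousLinearMap.comp_apply,
      ContinuousLinearMap.smulRight_apply, ContinuousLinearMap.coe_fst',
      ContinuousLinearMap.coe_snd', h6, fderiv_const_apply, zero_apply,
      smul_eq_mul]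
    module
  · simp

end IsWarpedCoord
end WarpedCoordinates

/-! ### Ricci tensor and Hessian of the warped product. -/

section WarpedRicci

variable {V W : Type*} [NormedAddCommGroup V] [NormedSpace ℝ V]
  [NormedAddCommGroup W] [NormedSpace ℝ W]

/-- The identity is `inl ∘ fst + inr ∘ snd` and the trace is cyclic. Only the two diagonal blocks of
the curvature endomorphism are therefore needed. -/
lemma trace_prod_eq [FiniteDimensional ℝ V] [FiniteDimensional ℝ W] (T : (V × W) →ₗ[ℝ] (V × W)) :
    LinearMap.trace ℝ (V × W) T =
      LinearMap.trace ℝ V (LinearMap.fst ℝ V W ∘ₗ T ∘ₗ LinearMap.inl ℝ V W)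
        + LinearMap.trace ℝ W (LinearMap.snd ℝ V W ∘ₗ T ∘ₗ LinearMap.inr ℝ V W) := by
  rw [LinearMap.trace_comp_comm' (T ∘ₗ LinearMap.inl ℝ V W),
    LinearMap.trace_comp_comm' (T ∘ₗ LinearMap.inr ℝ V W), ← map_add]
  congr 1
  ext X <;> simp [← Prod.zero_eq_mk]

variable {B : V →L[ℝ] V →L[ℝ] ℝ} {a : V →L[ℝ] ℝ} {s : V} {φ f p q r : ℝ → ℝ}
    {K : W → W →L[ℝ] W →L[ℝ] ℝ} {U : Set W}

namespace IsWarpedCoord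

lemma christoffel_fiber_comm (H : IsWarpedCoord B a s φ f p q r K U) {y : W} (hy : y ∈ U)
    (v w : W) : christoffel K y v w = christoffel K y w v :=
  christoffel_comm ((H.contDiffAt_fiber hy).differentiableAt (by simp))
    (Filter.mem_of_superset (H.isOpen.mem_nhds hy) H.symm_fiber) v w

variable [FiniteDimensional ℝ V] [FiniteDimensional ℝ W]

/-- The value of `a` on the base component of a Christoffel symbol. -/
lemma functional_christoffel (H : IsWarpedCoord B a s φ f p q r K U) {z : V × W} (hz : z.2 ∈ U)
    (X Y : V × W) :
    a (christoffel (warpedCoord B a φ f K) z X Y).1 =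
      -p (a z.1) * (2 * a X.1 * a Y.1 - a s * B X.1 Y.1) - r (a z.1) * K z.2 X.2 Y.2 * a s := by
  rw [H.christoffel_eq hz]
  simp only [map_add, map_sub, map_smul, smul_eq_mul]
  ring

/-- The block is arranged as a multiple of the identity plus rank-one maps, whose traces are
evaluations of a functional at a vector. -/
lemma curvatureEnd_base (H : IsWarpedCoord B a s φ f p q r K U) {z : V × W} (hz : z.2 ∈ U)
    (X Y : V × W) :
    LinearMap.fst ℝ V W ∘ₗ (curvatureEnd (warpedCoord B a φ f K) z X Y).toLinearMap
        ∘ₗ LinearMap.inl ℝ V W =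
      (deriv p (a z.1) * a X.1 * a Y.1
          - p (a z.1) * a (christoffel (warpedCoord B a φ f K) z X Y).1
          - p (a z.1) ^ 2 * a X.1 * a Y.1) • LinearMap.id
        + a.toLinearMap.smulRight
          (-deriv p (a z.1) • (a X.1 • Y.1 + a Y.1 • X.1 - B X.1 Y.1 • s)
            - (deriv r (a z.1) * K z.2 X.2 Y.2) • s
            + (deriv p (a z.1) * a X.1) • Y.1
            - p (a z.1) • (christoffel (warpedCoord B a φ f K) z X Y).1
            - p (a z.1) ^ 2 • (a X.1 • Y.1 + (2 * a Y.1) • X.1 - B X.1 Y.1 • s)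
            + (r (a z.1) * q (a z.1) * K z.2 X.2 Y.2) • s)
        + (B Y.1).toLinearMap.smulRight
          (-(deriv p (a z.1) * a X.1) • s + (p (a z.1) ^ 2 * a s) • X.1)
        + (B X.1).toLinearMap.smulRight ((p (a z.1) ^ 2 * a Y.1) • s)
        + (B (christoffel (warpedCoord B a φ f K) z X Y).1).toLinearMap.smulRight
          (p (a z.1) • s) := by
  ext u
  have hs : B X.1 s = a X.1 := by rw [H.symm_base, H.grad]
  have h1 := H.symm_base u Y.1
  simp only [LinearMap.comp_apply, LinearMap.inl_apply, LinearMap.fst_apply,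
    ContinuousLinearMap.coe_coe, curvatureEnd_apply]
  -- The inner symbol Γ(X, Y) may stay opaque: for `u` in the base, its fibre component does not
  -- enter the base part of Γ(u, Γ(X, Y)).
  generalize christoffel (warpedCoord B a φ f K) z X Y = g
  have h2 := H.symm_base u g.1
  simp only [H.fderiv_christoffel hz, H.christoffel_eq hz, Prod.fst_add, Prod.fst_sub,
    LinearMap.add_apply, LinearMap.smul_apply, LinearMap.id_apply, LinearMap.smulRight_apply]
  simp only [map_add, map_sub, map_smul, map_zero, smul_eq_mul, hs, h1, h2, zero_apply, neg_smul,
    map_neg, add_zero, smul_zero, zero_add, ContinuousLinearMap.coe_coe]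
  module

lemma curvatureEnd_fiber (H : IsWarpedCoord B a s φ f p q r K U) {z : V × W} (hz : z.2 ∈ U)
    (X Y : V × W) :
    LinearMap.snd ℝ V W ∘ₗ (curvatureEnd (warpedCoord B a φ f K) z X Y).toLinearMap
        ∘ₗ LinearMap.inr ℝ V W =
      (curvatureEnd K z.2 X.2 Y.2).toLinearMap
        + (-deriv q (a z.1) * a X.1 * a Y.1
            + q (a z.1) * a (christoffel (warpedCoord B a φ f K) z X Y).1
            - q (a z.1) ^ 2 * a X.1 * a Y.1) • LinearMap.id
        + (K z.2 Y.2).toLinearMap.smulRight ((q (a z.1) * r (a z.1) * a s) • X.2) := by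
  ext u
  have h1 := H.symm_fiber _ hz u Y.2
  -- Torsion-freeness cancels the cross terms `q a(Y) Γ_K(u, X)` and `q a(Y) Γ_K(X, u)`.
  have h2 := H.christoffel_fiber_comm hz u X.2
  simp only [LinearMap.comp_apply, LinearMap.inr_apply, LinearMap.snd_apply,
    ContinuousLinearMap.coe_coe, curvatureEnd_apply]
  -- The fibre component of Γ(X, Y) must be expanded to recognise the curvature of `K`; the base
  -- component enters only through `a`.
  have hg := congrArg Prod.snd (H.christoffel_eq hz X Y)
  generalize christoffel (warpedCoord B a φ f K) z X Y = g at hg ⊢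
  simp only [H.fderiv_christoffel hz, H.christoffel_eq hz, hg, Prod.snd_add, Prod.snd_sub,
    LinearMap.add_apply, LinearMap.smul_apply, LinearMap.id_apply, LinearMap.smulRight_apply,
    ContinuousLinearMap.coe_coe, curvatureEnd_apply]
  simp only [map_add, map_sub, map_smul, map_zero, smul_eq_mul, h1, h2,
    zero_apply, neg_smul, map_neg, zero_smul, add_zero, smul_zero, zero_add]
  module

/-- The Ricci tensor of the warped product metric `φ(a x)⁻² B + f(a x)² K(y)`. -/
lemma ricciCoord_eq (H : IsWarpedCoord B a s φ f p q r K U) {z : V × W} (hz : z.2 ∈ U)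
    (X Y : V × W) :
    ricciCoord (warpedCoord B a φ f K) z X Y =
      ((Module.finrank ℝ V - 2) * (deriv p (a z.1) + p (a z.1) ^ 2)
          - Module.finrank ℝ W * (deriv q (a z.1) + q (a z.1) ^ 2 + 2 * p (a z.1) * q (a z.1)))
          * (a X.1 * a Y.1)
        + a s * (deriv p (a z.1) - (Module.finrank ℝ V - 2) * p (a z.1) ^ 2
          + Module.finrank ℝ W * (p (a z.1) * q (a z.1))) * B X.1 Y.1
        + a s * (Module.finrank ℝ V * (p (a z.1) * r (a z.1)) - deriv r (a z.1)
          + (2 - Module.finrank ℝ W) * (q (a z.1) * r (a z.1))) * K z.2 X.2 Y.2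
        + ricciCoord K z.2 X.2 Y.2 := by
  have hs : ∀ v, B v s = a v := fun v => by rw [H.symm_base, H.grad]
  rw [ricciCoord, trace_prod_eq, H.curvatureEnd_base hz, H.curvatureEnd_fiber hz, ricciCoord]
  simp only [map_add, map_smul, LinearMap.trace_smulRight, LinearMap.trace_id, smul_eq_mul,
    ContinuousLinearMap.coe_coe, map_sub, hs, H.symm_base Y.1 X.1, H.symm_fiber _ hz Y.2 X.2,
    H.functional_christoffel hz]
  ring

/-- The Hessian of a function of `a x` for the warped product metric. -/
lemma hessianCoord_eq (H : IsWarpedCoord B a s φ f p q r K U) {z : V × W} (hz : z.2 ∈ U)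
    {h : ℝ → ℝ} (hh : ContDiff ℝ ∞ h) (X Y : V × W) :
    hessianCoord (warpedCoord B a φ f K) (fun z => h (a z.1)) z X Y =
      (deriv (deriv h) (a z.1) + 2 * p (a z.1) * deriv h (a z.1)) * (a X.1 * a Y.1)
        - a s * (deriv h (a z.1) * p (a z.1)) * B X.1 Y.1
        + a s * (deriv h (a z.1) * r (a z.1)) * K z.2 X.2 Y.2 := by
  have h1 : Differentiable ℝ h := hh.differentiable (by simp)
  have h2 : Differentiable ℝ (deriv h) :=
    (contDiff_infty_iff_deriv.1 hh).2.differentiable (by simp)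
  set L : V × W →L[ℝ] ℝ := a ∘L ContinuousLinearMap.fst ℝ V W
  have hL : ∀ z : V × W, L z = a z.1 := fun _ => rfl
  have hd : fderiv ℝ (fun z : V × W => h (a z.1)) = fun z => deriv h (L z) • L := by
    ext1 z
    exact ((h1 (L z)).hasDerivAt.comp_hasFDerivAt z L.hasFDerivAt).fderiv
  have hdd : fderiv ℝ (fun z : V × W => deriv h (L z) • L) z
      = (deriv (deriv h) (L z) • L).smulRight L :=
    (((h2 (L z)).hasDerivAt.comp_hasFDerivAt z L.hasFDerivAt).smul_const L).fderiv
  rw [hessianCoord, hd, hdd]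
  simp only [ContinuousLinearMap.smulRight_apply, smul_apply, hL, smul_eq_mul,
    H.functional_christoffel hz]
  ring

end IsWarpedCoord
end WarpedRicci

/-! ### From the manifold to product charts. -/

section Charts

variable {n m : ℕ} {F : Type*} [TopologicalSpace F] [ChartedSpace (EuclideanSpace ℝ (Fin m)) F]

lemma extChartAt_euclidean_prod (p : EuclideanSpace ℝ (Fin n) × F) :
    extChartAt ((𝓡 n).prod (𝓡 m)) p =
      (PartialEquiv.refl (EuclideanSpace ℝ (Fin n))).prod (extChartAt (𝓡 m) p.2) := by
  rw [extChartAt_prod, extChartAt_model_space_eq_id]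

/-- The linear functional `x ↦ ∑ i, α i x_i`. -/
def xiFunctional (α : Fin n → ℝ) : EuclideanSpace ℝ (Fin n) →L[ℝ] ℝ :=
  ∑ i, α i • (EuclideanSpace.proj i : EuclideanSpace ℝ (Fin n) →L[ℝ] ℝ)

lemma ofXi_eq (α : Fin n → ℝ) (u : ℝ → ℝ) : ofXi α u = fun x => u (xiFunctional α x) := by
  ext x
  simp [ofXi, xiFunctional]

lemma pseudoEuclideanForm_apply (ε : Fin n → ℝ) (v w : EuclideanSpace ℝ (Fin n)) :
    pseudoEuclideanForm ε v w = ∑ i, ε i * v i * w i := by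
  simp [pseudoEuclideanForm, mul_assoc]

lemma chartMetric_apply {E H M : Type*} [NormedAddCommGroup E] [NormedSpace ℝ E]
    [TopologicalSpace H] {I : ModelWithCorners ℝ E H} [TopologicalSpace M] [ChartedSpace H M]
    (g : BilinField I M) (q : M) (y v w : E) :
    chartMetric g q y v w = g ((extChartAt I q).symm y)
      (mfderiv 𝓘(ℝ, E) I (extChartAt I q).symm y v)
      (mfderiv 𝓘(ℝ, E) I (extChartAt I q).symm y w) := rfl

lemma warpedMetric_apply {V : Type*} [NormedAddCommGroup V] [NormedSpace ℝ V]
    (gB : BilinField 𝓘(ℝ, V) V) (u : V → ℝ)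
    (gF : BilinField (𝓡 m) F) (p : V × F)
    (X Y : TangentSpace (𝓘(ℝ, V).prod (𝓡 m)) p) :
    warpedMetric gB u gF p X Y =
      gB p.1 (X : V × EuclideanSpace ℝ (Fin m)).1 (Y : V × EuclideanSpace ℝ (Fin m)).1
        + u p.1 ^ 2 * gF p.2 (X : V × EuclideanSpace ℝ (Fin m)).2
          (Y : V × EuclideanSpace ℝ (Fin m)).2 := by
  have : warpedMetric gB u gF p X Y =
      gB p.1 (mfderiv (𝓘(ℝ, V).prod (𝓡 m)) 𝓘(ℝ, V) Prod.fst p X)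
        (mfderiv (𝓘(ℝ, V).prod (𝓡 m)) 𝓘(ℝ, V) Prod.fst p Y)
        + u p.1 ^ 2 * gF p.2 (mfderiv (𝓘(ℝ, V).prod (𝓡 m)) (𝓡 m) Prod.snd p X)
          (mfderiv (𝓘(ℝ, V).prod (𝓡 m)) (𝓡 m) Prod.snd p Y) := rfl
  rw [this, mfderiv_fst, mfderiv_snd]
  rfl

lemma warpedMetric_conformalPseudoEuclidean_apply (ε α : Fin n → ℝ) (φ f : ℝ → ℝ)
    (gF : BilinField (𝓡 m) F) (p : EuclideanSpace ℝ (Fin n) × F)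
    (X Y : EuclideanSpace ℝ (Fin n) × EuclideanSpace ℝ (Fin m)) :
    warpedMetric (conformalPseudoEuclidean ε (ofXi α φ)) (ofXi α f) gF p X Y =
      1 / ofXi α φ p.1 ^ 2 * pseudoEuclideanForm ε X.1 Y.1
        + ofXi α f p.1 ^ 2 * gF p.2 X.2 Y.2 :=
  warpedMetric_apply _ _ _ _ _ _

variable [IsManifold (𝓡 m) ∞ F]

lemma mdifferentiableAt_extChartAt_symm_of_mem {q : F} {y : EuclideanSpace ℝ (Fin m)}
    (hy : y ∈ (extChartAt (𝓡 m) q).target) :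
    MDifferentiableAt 𝓘(ℝ, EuclideanSpace ℝ (Fin m)) (𝓡 m) (extChartAt (𝓡 m) q).symm y :=
  ((contMDiffOn_extChartAt_symm (n := ∞) q).contMDiffAt
    ((isOpen_extChartAt_target q).mem_nhds hy)).mdifferentiableAt (by simp)

lemma mdifferentiableAt_extChartAt_symm_prod {p : EuclideanSpace ℝ (Fin n) × F}
    {z : EuclideanSpace ℝ (Fin n) × EuclideanSpace ℝ (Fin m)}
    (hz : z.2 ∈ (extChartAt (𝓡 m) p.2).target) :
    MDifferentiableAt 𝓘(ℝ, EuclideanSpace ℝ (Fin n) × EuclideanSpace ℝ (Fin m))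
      ((𝓡 n).prod (𝓡 m)) (extChartAt ((𝓡 n).prod (𝓡 m)) p).symm z := by
  have hz' : z ∈ (extChartAt ((𝓡 n).prod (𝓡 m)) p).target := by
    rw [extChartAt_euclidean_prod]
    exact ⟨trivial, hz⟩
  exact ((contMDiffOn_extChartAt_symm (n := ∞) p).contMDiffAt
    ((isOpen_extChartAt_target p).mem_nhds hz')).mdifferentiableAt (by simp)

/-- At the centre of its own chart, the inverse chart has the identity as derivative, because
tangent spaces are identified with the model space through that chart. -/
lemma chartMetric_self (gF : BilinField (𝓡 m) F) (q : F) :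
    chartMetric gF q (extChartAt (𝓡 m) q q) = gF q := by
  have h : mfderiv 𝓘(ℝ, EuclideanSpace ℝ (Fin m)) (𝓡 m) (extChartAt (𝓡 m) q).symm
      (extChartAt (𝓡 m) q q) = ContinuousLinearMap.id ℝ _ := by
    rw [← mfderivWithin_univ]
    have : IsManifold (𝓡 m) 1 F := IsManifold.of_le (n := ∞) (by norm_cast)
    have := mfderivWithin_range_extChartAt_symm (I := 𝓡 m) (x := q)
    simpa using this
  have h' : ∀ q', q' = q → ∀ v w : EuclideanSpace ℝ (Fin m),
      (gF q' : EuclideanSpace ℝ (Fin m) →L[ℝ] EuclideanSpace ℝ (Fin m) →L[ℝ] ℝ) v w =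
        gF q v w := by
    rintro _ rfl _ _
    rfl
  ext v w
  rw [chartMetric_apply, h]
  exact h' _ (extChartAt_to_inv q) v w

/-- The chain rule is applied to the compositions of the inverse chart with the two projections. -/
lemma mfderiv_symm_prod {p : EuclideanSpace ℝ (Fin n) × F}
    {z : EuclideanSpace ℝ (Fin n) × EuclideanSpace ℝ (Fin m)}
    (hz : z.2 ∈ (extChartAt (𝓡 m) p.2).target) 
    (X : EuclideanSpace ℝ (Fin n) × EuclideanSpace ℝ (Fin m)) :
    (mfderiv 𝓘(ℝ, EuclideanSpace ℝ (Fin n) × EuclideanSpace ℝ (Fin m)) ((𝓡 n).prod (𝓡 m))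
      (extChartAt ((𝓡 n).prod (𝓡 m)) p).symm z X :
        EuclideanSpace ℝ (Fin n) × EuclideanSpace ℝ (Fin m)) =
    (X.1, mfderiv 𝓘(ℝ, EuclideanSpace ℝ (Fin m)) (𝓡 m) (extChartAt (𝓡 m) p.2).symm z.2 X.2) := by
  have h := mdifferentiableAt_extChartAt_symm_prod hz
  have h1 := mfderiv_comp z (mdifferentiableAt_fst (I := 𝓡 n) (I' := 𝓡 m)
    (x := (extChartAt ((𝓡 n).prod (𝓡 m)) p).symm z)) h
  have h2 := mfderiv_comp z (mdifferentiableAt_snd (I := 𝓡 n) (I' := 𝓡 m)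
    (x := (extChartAt ((𝓡 n).prod (𝓡 m)) p).symm z)) h
  have e1 : (Prod.fst ∘ (extChartAt ((𝓡 n).prod (𝓡 m)) p).symm) =
      (Prod.fst : EuclideanSpace ℝ (Fin n) × EuclideanSpace ℝ (Fin m) → _) := by
    rw [extChartAt_euclidean_prod]
    rfl
  have e2 : (Prod.snd ∘ (extChartAt ((𝓡 n).prod (𝓡 m)) p).symm) =
      (extChartAt (𝓡 m) p.2).symm ∘
        (Prod.snd : EuclideanSpace ℝ (Fin n) × EuclideanSpace ℝ (Fin m) → _) := by
    rw [extChartAt_euclidean_prod]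
    rfl
  have h3 := mfderiv_comp (I := 𝓘(ℝ, EuclideanSpace ℝ (Fin n) × EuclideanSpace ℝ (Fin m))) z
    (mdifferentiableAt_extChartAt_symm_of_mem hz)
    (differentiableAt_snd (𝕜 := ℝ)).mdifferentiableAt
  rw [e1, mfderiv_fst, mfderiv_eq_fderiv, fderiv_fst] at h1
  rw [e2, h3, mfderiv_snd, mfderiv_eq_fderiv, fderiv_snd] at h2
  have h1' := DFunLike.congr_fun h1 X
  have h2' := DFunLike.congr_fun h2 X
  exact Prod.ext h1'.symm h2'.symm

lemma chartMetric_nondegenerate {gF : BilinField (𝓡 m) F} (hF : IsSemiRiemannianMetric gF) {q : F}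
    {y : EuclideanSpace ℝ (Fin m)} (hy : y ∈ (extChartAt (𝓡 m) q).target)
    (v : EuclideanSpace ℝ (Fin m)) (hv : ∀ w, chartMetric gF q y v w = 0) : v = 0 := by
  have : IsManifold (𝓡 m) 1 F := IsManifold.of_le (n := ∞) (by norm_cast)
  have h := isInvertible_mfderivWithin_extChartAt_symm (I := 𝓡 m) (x := q) hy
  rw [ModelWithCorners.range_eq_univ, mfderivWithin_univ] at h
  refine h.injective ?_
  refine (hF.nondegenerate _ _ fun w => ?_).trans (ContinuousLinearMap.map_zero _).symm
  -- The derivative of the inverse chart is an isomorphism, so every tangent vector of `F` is a test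
  -- vector seen in the chart.
  obtain ⟨w, rfl⟩ := h.surjective w
  exact hv w

lemma chartMetric_warpedMetric (ε α : Fin n → ℝ) (φ f : ℝ → ℝ) (gF : BilinField (𝓡 m) F)
    {p : EuclideanSpace ℝ (Fin n) × F} {z : EuclideanSpace ℝ (Fin n) × EuclideanSpace ℝ (Fin m)}
    (hz : z.2 ∈ (extChartAt (𝓡 m) p.2).target) :
    chartMetric (warpedMetric (conformalPseudoEuclidean ε (ofXi α φ)) (ofXi α f) gF) p z =
      warpedCoord (pseudoEuclideanForm ε) (xiFunctional α) φ f (chartMetric gF p.2) z := by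
  refine ContinuousLinearMap.ext fun X => ContinuousLinearMap.ext fun Y => ?_
  let D : EuclideanSpace ℝ (Fin n) × EuclideanSpace ℝ (Fin m) →
      EuclideanSpace ℝ (Fin n) × EuclideanSpace ℝ (Fin m) := fun X =>
    mfderiv 𝓘(ℝ, EuclideanSpace ℝ (Fin n) × EuclideanSpace ℝ (Fin m)) ((𝓡 n).prod (𝓡 m))
      (extChartAt ((𝓡 n).prod (𝓡 m)) p).symm z X
  have hX : D X = _ := mfderiv_symm_prod hz X
  have hY : D Y = _ := mfderiv_symm_prod hz Y
  have hsymm : (extChartAt ((𝓡 n).prod (𝓡 m)) p).symm z =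
      (z.1, (extChartAt (𝓡 m) p.2).symm z.2) := by
    rw [extChartAt_euclidean_prod]
    rfl
  have h : ∀ x, x = (z.1, (extChartAt (𝓡 m) p.2).symm z.2) →
      (warpedMetric (conformalPseudoEuclidean ε (ofXi α φ)) (ofXi α f) gF x :
        (EuclideanSpace ℝ (Fin n) × EuclideanSpace ℝ (Fin m)) →L[ℝ]
          (EuclideanSpace ℝ (Fin n) × EuclideanSpace ℝ (Fin m)) →L[ℝ] ℝ) (D X) (D Y)
      = warpedCoord (pseudoEuclideanForm ε) (xiFunctional α) φ f (chartMetric gF p.2) z X Y := by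
    rintro _ rfl
    refine (warpedMetric_conformalPseudoEuclidean_apply ε α φ f gF _ _ _).trans ?_
    rw [hX, hY, warpedCoord_apply, chartMetric_apply, ofXi_eq, ofXi_eq]
  exact (chartMetric_apply _ _ _ _ _).trans (h _ hsymm)

lemma pseudoEuclideanForm_nondegenerate {ε : Fin n → ℝ} (hε : ∀ i, ε i = 1 ∨ ε i = -1)
    (v : EuclideanSpace ℝ (Fin n)) (hv : ∀ w, pseudoEuclideanForm ε v w = 0) : v = 0 := by
  ext i
  have h := hv (EuclideanSpace.single i 1)
  rw [pseudoEuclideanForm_apply] at h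
  rcases hε i with hi | hi <;> simpa [Pi.single_apply, hi] using h

/-- The gradient of `xiFunctional α` with respect to `pseudoEuclideanForm ε`. -/
def xiGradient (ε α : Fin n → ℝ) : EuclideanSpace ℝ (Fin n) :=
  WithLp.toLp 2 fun i => ε i * α i

/-- Since `ε i = ±1`, raising an index is multiplication by `ε i`. -/
lemma pseudoEuclideanForm_xiGradient {ε : Fin n → ℝ} (hε : ∀ i, ε i = 1 ∨ ε i = -1)
    (α : Fin n → ℝ) (v : EuclideanSpace ℝ (Fin n)) :
    pseudoEuclideanForm ε (xiGradient ε α) v = xiFunctional α v := by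
  rw [pseudoEuclideanForm_apply]
  simp only [xiGradient, xiFunctional, sum_apply, smul_apply, PiLp.proj_apply,
    smul_eq_mul]
  refine Finset.sum_congr rfl fun i _ => ?_
  rcases hε i with hi | hi <;> simp [hi]

lemma xiFunctional_xiGradient (ε α : Fin n → ℝ) :
    xiFunctional α (xiGradient ε α) = ∑ i, ε i * α i ^ 2 := by
  simp only [xiGradient, xiFunctional, sum_apply, smul_apply, PiLp.proj_apply,
    smul_eq_mul]
  exact Finset.sum_congr rfl fun i _ => by ring

lemma isWarpedCoord_chart {ε : Fin n → ℝ} (hε : ∀ i, ε i = 1 ∨ ε i = -1) {gF : BilinField (𝓡 m) F}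
    (hF : IsSemiRiemannianMetric gF) (α : Fin n → ℝ) {φ f : ℝ → ℝ} (hφ : ContDiff ℝ ∞ φ)
    (hφ0 : ∀ t, φ t ≠ 0) (hf : ContDiff ℝ ∞ f) (hf0 : ∀ t, f t ≠ 0) (q : F) :
    IsWarpedCoord (pseudoEuclideanForm ε) (xiFunctional α) (xiGradient ε α) φ f
      (fun t => deriv φ t / φ t) (fun t => deriv f t / f t)
      (fun t => f t ^ 2 * (deriv f t / f t) * φ t ^ 2)
      (chartMetric gF q) (extChartAt (𝓡 m) q).target where
  symm_base v w := by
    rw [pseudoEuclideanForm_apply, pseudoEuclideanForm_apply]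
    exact Finset.sum_congr rfl fun i _ => by ring
  nondegenerate_base := pseudoEuclideanForm_nondegenerate hε
  grad := pseudoEuclideanForm_xiGradient hε α
  smooth_conformal := hφ
  conformal_ne := hφ0
  smooth_warping := hf
  warping_ne := hf0
  deriv_conformal t := (div_mul_cancel₀ _ (hφ0 t)).symm
  deriv_warping t := (div_mul_cancel₀ _ (hf0 t)).symm
  eq_mul _ := rfl
  isOpen := isOpen_extChartAt_target q
  smooth_fiber := hF.smooth q
  symm_fiber _ _ _ _ := hF.symm _ _ _
  nondegenerate_fiber _ hy := chartMetric_nondegenerate hF hy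

lemma isSemiRiemannianMetric_warpedMetric {ε : Fin n → ℝ} (hε : ∀ i, ε i = 1 ∨ ε i = -1)
    {gF : BilinField (𝓡 m) F} (hF : IsSemiRiemannianMetric gF) (α : Fin n → ℝ) {φ f : ℝ → ℝ}
    (hφ : ContDiff ℝ ∞ φ) (hφ0 : ∀ t, φ t ≠ 0) (hf : ContDiff ℝ ∞ f) (hf0 : ∀ t, f t ≠ 0) :
    IsSemiRiemannianMetric
      (warpedMetric (conformalPseudoEuclidean ε (ofXi α φ)) (ofXi α f) gF) where
  symm p v w := by
    have H := isWarpedCoord_chart hε hF α hφ hφ0 hf hf0 p.2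
    refine (warpedMetric_conformalPseudoEuclidean_apply ε α φ f gF p v w).trans
      (Eq.trans ?_ (warpedMetric_conformalPseudoEuclidean_apply ε α φ f gF p w v).symm)
    exact congrArg₂ (· + ·) (congrArg _ (H.symm_base _ _)) (congrArg _ (hF.symm _ _ _))
  nondegenerate p X hX := by
    have key : ∀ Y : EuclideanSpace ℝ (Fin n) × EuclideanSpace ℝ (Fin m), _ = (0 : ℝ) := fun Y =>
      (warpedMetric_conformalPseudoEuclidean_apply ε α φ f gF p X Y).symm.trans (hX Y)
    refine Prod.ext (pseudoEuclideanForm_nondegenerate hε _ fun v => ?_)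
      (hF.nondegenerate p.2 _ fun w => ?_)
    · have h := (congrArg _ (congrArg _ (ContinuousLinearMap.map_zero _).symm)).trans (key (v, 0))
      rw [mul_zero, add_zero] at h
      exact (mul_eq_zero.1 h).resolve_left (by simp [ofXi, hφ0])
    · have h := (congrArg (· + _)
        (congrArg _ (ContinuousLinearMap.map_zero _).symm)).trans (key (0, w))
      simp only [mul_zero, zero_add] at h
      exact (mul_eq_zero.1 h).resolve_left (by simp [ofXi, hf0])
  smooth p := by
    have H := isWarpedCoord_chart hε hF α hφ hφ0 hf hf0 p.2
    intro z hz
    have hz' : z.2 ∈ (extChartAt (𝓡 m) p.2).target := by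
      rw [extChartAt_euclidean_prod] at hz
      exact hz.2
    refine ((H.contDiffAt hz').congr_of_eventuallyEq ?_).contDiffWithinAt
    filter_upwards [(H.isOpen.preimage continuous_snd).mem_nhds hz'] with y hy
    exact chartMetric_warpedMetric ε α φ f gF hy

/-- The left-hand side of the soliton equation of the warped product metric. -/
lemma ricci_add_hessian_warpedMetric {ε : Fin n → ℝ} {gF : BilinField (𝓡 m) F} {c : ℝ}
    (hF : IsEinsteinMetric gF c) (α : Fin n → ℝ)
    {φ f h p q r : ℝ → ℝ} (hh : ContDiff ℝ ∞ h) (x : EuclideanSpace ℝ (Fin n) × F)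
    (H : IsWarpedCoord (pseudoEuclideanForm ε) (xiFunctional α) (xiGradient ε α) φ f p q r
      (chartMetric gF x.2) (extChartAt (𝓡 m) x.2).target)
    (X Y : EuclideanSpace ℝ (Fin n) × EuclideanSpace ℝ (Fin m))
    {e t k : ℝ} (he : e = ∑ i, ε i * α i ^ 2) (ht : t = xiFunctional α x.1)
    (hk : k = gF x.2 X.2 Y.2) :
    ricci (warpedMetric (conformalPseudoEuclidean ε (ofXi α φ)) (ofXi α f) gF) x X Y
      + hessian (warpedMetric (conformalPseudoEuclidean ε (ofXi α φ)) (ofXi α f) gF)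
        (fun p => ofXi α h p.1) x X Y =
      (((n : ℝ) - 2) * (deriv p t + p t ^ 2) - m * (deriv q t + q t ^ 2 + 2 * p t * q t)
          + deriv (deriv h) t + 2 * p t * deriv h t)
          * (xiFunctional α X.1 * xiFunctional α Y.1)
        + e * (deriv p t - ((n : ℝ) - 2) * p t ^ 2 + m * (p t * q t) - deriv h t * p t)
          * pseudoEuclideanForm ε X.1 Y.1
        + (e * (n * (p t * r t) - deriv r t + (2 - (m : ℝ)) * (q t * r t) + deriv h t * r t) + c)
          * k := by
  set z : EuclideanSpace ℝ (Fin n) × EuclideanSpace ℝ (Fin m) := (x.1, extChartAt (𝓡 m) x.2 x.2)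
    with hzdef
  have hzx : extChartAt ((𝓡 n).prod (𝓡 m)) x x = z := by
    rw [extChartAt_euclidean_prod]
    rfl
  have hz : z.2 ∈ (extChartAt (𝓡 m) x.2).target := mem_extChartAt_target x.2
  have hev : chartMetric (warpedMetric (conformalPseudoEuclidean ε (ofXi α φ)) (ofXi α f) gF) x
      =ᶠ[nhds z] warpedCoord (pseudoEuclideanForm ε) (xiFunctional α) φ f (chartMetric gF x.2) := by
    filter_upwards [(H.isOpen.preimage continuous_snd).mem_nhds hz] with y hy
    exact chartMetric_warpedMetric ε α φ f gF hy
  have hfun : (fun p : EuclideanSpace ℝ (Fin n) × F => ofXi α h p.1) ∘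
      (extChartAt ((𝓡 n).prod (𝓡 m)) x).symm = fun z => h (xiFunctional α z.1) := by
    rw [ofXi_eq, extChartAt_euclidean_prod]
    rfl
  -- The product chart at `x` restricts to the fibre chart at `x.2`, the one in which the Ricci
  -- tensor of `F` at `x.2` is defined, so the Einstein condition applies directly.
  have hE : ricciCoord (chartMetric gF x.2) z.2 X.2 Y.2 = c * k :=
    (hF.ricci_eq x.2 X.2 Y.2).trans (congrArg (c * ·) hk.symm)
  have hK : chartMetric gF x.2 z.2 X.2 Y.2 = k :=
    (congrArg (fun b : EuclideanSpace ℝ (Fin m) →L[ℝ] EuclideanSpace ℝ (Fin m) →L[ℝ] ℝ =>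
      b X.2 Y.2) (chartMetric_self gF x.2)).trans hk.symm
  change ricciCoord (chartMetric _ x) (extChartAt ((𝓡 n).prod (𝓡 m)) x x) X Y
    + hessianCoord (chartMetric _ x) ((fun p : EuclideanSpace ℝ (Fin n) × F => ofXi α h p.1) ∘
      (extChartAt ((𝓡 n).prod (𝓡 m)) x).symm) (extChartAt ((𝓡 n).prod (𝓡 m)) x x) X Y = _
  rw [hzx, hfun, ricciCoord_congr hev, hessianCoord_congr hev, H.ricciCoord_eq hz,
    H.hessianCoord_eq hz hh, hE, hK, xiFunctional_xiGradient, ← he, ← ht, finrank_euclideanSpace,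
    finrank_euclideanSpace, Fintype.card_fin, Fintype.card_fin]
  ring

end Charts

/-! ### Separation of coefficients and the system of equations. -/

/-- A combination of `a ⊗ a`, `B` and `K` with `B`, `K` nondegenerate, `a ≠ 0` and `dim V ≥ 2`,
vanishes only if all its coefficients do. -/
lemma coefficients_eq_zero {V W : Type*} [NormedAddCommGroup V] [NormedSpace ℝ V]
    [FiniteDimensional ℝ V] [NormedAddCommGroup W] [NormedSpace ℝ W] [Nontrivial W]
    (hV : 2 ≤ Module.finrank ℝ V) {B : V →L[ℝ] V →L[ℝ] ℝ}
    (hB : ∀ v, (∀ w, B v w = 0) → v = 0) {a : V →L[ℝ] ℝ} {s : V} (hs : a s ≠ 0)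
    {K : W →L[ℝ] W →L[ℝ] ℝ} (hK : ∀ v, (∀ w, K v w = 0) → v = 0) {A₁ A₂ A₃ : ℝ}
    (h : ∀ X Y : V × W,
      A₁ * (a X.1 * a Y.1) + A₂ * B X.1 Y.1 + A₃ * K X.2 Y.2 = 0) :
    A₁ = 0 ∧ A₂ = 0 ∧ A₃ = 0 := by
  have h3 : A₃ = 0 := by
    obtain ⟨w, hw⟩ := exists_ne (0 : W)
    by_contra hne
    refine hw (hK w fun w' => ?_)
    simpa [hne] using h (0, w) (0, w')
  have h2 : A₂ = 0 := by
    -- The range of `a` has dimension at most 1 and `V` at least 2, so `a` kills some `v ≠ 0`.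
    -- Testing on `v` removes the term `a ⊗ a`.
    obtain ⟨v, hv, hv0⟩ : ∃ v, v ∈ LinearMap.ker a.toLinearMap ∧ v ≠ 0 := by
      refine (Submodule.ne_bot_iff _).1 fun hbot => ?_
      have h1 := LinearMap.finrank_range_add_finrank_ker a.toLinearMap
      rw [hbot, finrank_bot] at h1
      have h2 := Submodule.finrank_le (LinearMap.range a.toLinearMap)
      rw [Module.finrank_self] at h2
      omega
    have hav : a v = 0 := hv
    by_contra hne
    refine hv0 (hB v fun w => ?_)
    simpa [hne, hav] using h (v, 0) (w, 0)
  exact ⟨by simpa [h2, hs] using h (s, 0) (s, 0), h2, h3⟩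

section System

variable {n m : ℕ} {e c : ℝ} {φ f h p q r : ℝ → ℝ} {t : ℝ}

/-- The three equations of the system at `t` say that the coefficients of the soliton equation
vanish. -/
lemma system_iff_coefficients (hφ : Differentiable ℝ φ) (hφ0 : ∀ t, φ t ≠ 0)
    (hf : Differentiable ℝ f) (hf0 : ∀ t, f t ≠ 0) (hp : Differentiable ℝ p)
    (hq : Differentiable ℝ q) (hφp : ∀ t, deriv φ t = p t * φ t)
    (hfq : ∀ t, deriv f t = q t * f t) (hr : ∀ t, r t = f t ^ 2 * q t * φ t ^ 2) (ρ : ℝ) :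
    (f t * (((n : ℝ) - 2) * deriv (deriv φ) t + 2 * deriv φ t * deriv h t
          + φ t * deriv (deriv h) t)
        - m * φ t * deriv (deriv f) t - 2 * m * deriv φ t * deriv f t = 0 ∧
    e * (f t * φ t * deriv (deriv φ) t - ((n : ℝ) - 1) * f t * (deriv φ t) ^ 2
        + m * φ t * deriv φ t * deriv f t - f t * φ t * deriv φ t * deriv h t) = ρ * f t ∧
    e * (-(f t * φ t ^ 2 * deriv (deriv f) t) + ((n : ℝ) - 2) * f t * φ t * deriv f t * deriv φ t
        - ((m : ℝ) - 1) * φ t ^ 2 * (deriv f t) ^ 2 + f t * φ t ^ 2 * deriv f t * deriv h t)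
      = ρ * f t ^ 2 - c) ↔
    (((n : ℝ) - 2) * (deriv p t + p t ^ 2) - m * (deriv q t + q t ^ 2 + 2 * p t * q t)
          + deriv (deriv h) t + 2 * p t * deriv h t = 0 ∧
      e * (deriv p t - ((n : ℝ) - 2) * p t ^ 2 + m * (p t * q t) - deriv h t * p t)
        - ρ / φ t ^ 2 = 0 ∧
      e * (n * (p t * r t) - deriv r t + (2 - (m : ℝ)) * (q t * r t) + deriv h t * r t) + c
        - ρ * f t ^ 2 = 0) := by
  have hφ' : HasDerivAt φ (p t * φ t) t := hφp t ▸ (hφ t).hasDerivAt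
  have hf' : HasDerivAt f (q t * f t) t := hfq t ▸ (hf t).hasDerivAt
  have hφ2 : deriv (deriv φ) t = (deriv p t + p t ^ 2) * φ t := by
    rw [funext hφp, ((hp t).hasDerivAt.fun_mul hφ').deriv]
    ring
  have hf2 : deriv (deriv f) t = (deriv q t + q t ^ 2) * f t := by
    rw [funext hfq, ((hq t).hasDerivAt.fun_mul hf').deriv]
    ring
  have hr' : deriv r t =
      2 * f t ^ 2 * q t ^ 2 * φ t ^ 2 + f t ^ 2 * deriv q t * φ t ^ 2
        + 2 * f t ^ 2 * q t * p t * φ t ^ 2 := by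
    rw [funext hr, (((hf'.fun_pow 2).fun_mul (hq t).hasDerivAt).fun_mul (hφ'.fun_pow 2)).deriv]
    push_cast
    ring
  have h1 := hφ0 t
  have h2 := hf0 t
  rw [hφ2, hf2, hr', hφp, hfq, hr]
  refine and_congr ?_ (and_congr ?_ ?_)
  -- The first equation is `φ f` times the first coefficient, the second `φ² f` times the second;
  -- the third needs no factor.
  · refine (Eq.congr_left ?_).trans (mul_eq_zero_iff_left (mul_ne_zero h1 h2))
    ring
  · rw [← sub_eq_zero]
    refine (Eq.congr_left ?_).trans (mul_eq_zero_iff_left (mul_ne_zero (pow_ne_zero 2 h1) h2))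
    field_simp
    ring
  · rw [← sub_eq_zero]
    refine Eq.congr_left ?_
    ring

end System

/-- A functional with `a s ≠ 0` already takes every value on the line through `s`. -/
lemma exists_xiFunctional_eq {n : ℕ} {ε α : Fin n → ℝ} (hα : ∑ i, ε i * α i ^ 2 ≠ 0) (t : ℝ) :
    ∃ x, xiFunctional α x = t := by
  refine ⟨(t / ∑ i, ε i * α i ^ 2) • xiGradient ε α, ?_⟩
  rw [map_smul, xiFunctional_xiGradient, smul_eq_mul, div_mul_cancel₀ _ hα]

/-- At a point over `t = ξ(x)`, the soliton equation of the warped product metric is equivalent to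
the three equations of the system at `t`. -/
lemma soliton_eq_iff_system {n m : ℕ} (hn : 3 ≤ n) (hm : 1 ≤ m)
    {ε : Fin n → ℝ} (hε : ∀ i, ε i = 1 ∨ ε i = -1)
    {F : Type*} [TopologicalSpace F] [ChartedSpace (EuclideanSpace ℝ (Fin m)) F]
    [IsManifold (𝓡 m) ∞ F] {gF : BilinField (𝓡 m) F} {c : ℝ} (hF : IsEinsteinMetric gF c)
    {α : Fin n → ℝ} (hα : ∑ i, ε i * α i ^ 2 ≠ 0)
    {φ f h : ℝ → ℝ} (hφ : ContDiff ℝ ∞ φ) (hφ0 : ∀ t, φ t ≠ 0)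
    (hf : ContDiff ℝ ∞ f) (hf0 : ∀ t, f t ≠ 0) (hh : ContDiff ℝ ∞ h)
    (x : EuclideanSpace ℝ (Fin n) × F) {t : ℝ} (ht : t = xiFunctional α x.1) (ρ : ℝ) :
    (∀ X Y : TangentSpace ((𝓡 n).prod (𝓡 m)) x,
      ricci (warpedMetric (conformalPseudoEuclidean ε (ofXi α φ)) (ofXi α f) gF) x X Y
        + hessian (warpedMetric (conformalPseudoEuclidean ε (ofXi α φ)) (ofXi α f) gF)
          (fun p => ofXi α h p.1) x X Y
      = ρ * warpedMetric (conformalPseudoEuclidean ε (ofXi α φ)) (ofXi α f) gF x X Y) ↔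
    (f t * (((n : ℝ) - 2) * deriv (deriv φ) t + 2 * deriv φ t * deriv h t
          + φ t * deriv (deriv h) t)
        - m * φ t * deriv (deriv f) t - 2 * m * deriv φ t * deriv f t = 0 ∧
    (∑ i, ε i * α i ^ 2) * (f t * φ t * deriv (deriv φ) t - ((n : ℝ) - 1) * f t * (deriv φ t) ^ 2
        + m * φ t * deriv φ t * deriv f t - f t * φ t * deriv φ t * deriv h t) = ρ * f t ∧
    (∑ i, ε i * α i ^ 2) * (-(f t * φ t ^ 2 * deriv (deriv f) t)
        + ((n : ℝ) - 2) * f t * φ t * deriv f t * deriv φ t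
        - ((m : ℝ) - 1) * φ t ^ 2 * (deriv f t) ^ 2 + f t * φ t ^ 2 * deriv f t * deriv h t)
      = ρ * f t ^ 2 - c) := by
  have H := isWarpedCoord_chart hε hF.isSemiRiemannianMetric α hφ hφ0 hf hf0 x.2
  have hW : Nontrivial (EuclideanSpace ℝ (Fin m)) :=
    Module.nontrivial_of_finrank_pos (R := ℝ) (by rw [finrank_euclideanSpace_fin]; omega)
  have hV : 2 ≤ Module.finrank ℝ (EuclideanSpace ℝ (Fin n)) := by
    rw [finrank_euclideanSpace_fin]
    omega
  have hs : xiFunctional α (xiGradient ε α) ≠ 0 := by rwa [xiFunctional_xiGradient]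
  have hφt : ofXi α φ x.1 = φ t := by rw [ofXi_eq, ht]
  have hft : ofXi α f x.1 = f t := by rw [ofXi_eq, ht]
  rw [system_iff_coefficients (hφ.differentiable (by simp)) hφ0 (hf.differentiable (by simp)) hf0
    H.differentiable_p H.differentiable_q H.deriv_conformal H.deriv_warping H.eq_mul ρ]
  constructor
  · intro hsol
    refine coefficients_eq_zero (W := EuclideanSpace ℝ (Fin m)) (K := gF x.2) hV
      H.nondegenerate_base hs
      (hF.isSemiRiemannianMetric.nondegenerate x.2) fun X Y => ?_
    have h1 := ricci_add_hessian_warpedMetric hF α hh x H X Y rfl ht rfl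
    have h2 := warpedMetric_conformalPseudoEuclidean_apply ε α φ f gF x X Y
    have h3 := (h1.symm.trans (hsol X Y)).trans (congrArg (ρ * ·) h2)
    rw [hφt, hft] at h3
    linear_combination h3
  · rintro ⟨h1, h2, h3⟩
    refine fun (X Y : EuclideanSpace ℝ (Fin n) × EuclideanSpace ℝ (Fin m)) => ?_
    refine (ricci_add_hessian_warpedMetric hF α hh x H X Y rfl ht rfl).trans
      (Eq.trans ?_ (congrArg (ρ * ·)
        (warpedMetric_conformalPseudoEuclidean_apply ε α φ f gF x X Y).symm))
    rw [h1, sub_eq_zero.1 h2, sub_eq_zero.1 h3, hφt, hft]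
    ring

end

theorem theorem1p4 {n m : ℕ} (hn : 3 ≤ n) (hm : 1 ≤ m)
    (ε : Fin n → ℝ) (hε : ∀ i, ε i = 1 ∨ ε i = -1)
    {F : Type*} [TopologicalSpace F] [ChartedSpace (EuclideanSpace ℝ (Fin m)) F]
    [IsManifold (𝓡 m) ∞ F] [Nonempty F]
    (gF : BilinField (𝓡 m) F) (lamF : ℝ) (hF : IsEinsteinMetric gF lamF)
    (α : Fin n → ℝ) (hα : ∑ i, ε i * α i ^ 2 ≠ 0)
    (φ f h : ℝ → ℝ) (hφ : ContDiff ℝ ∞ φ) (hφ0 : ∀ t, φ t ≠ 0)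
    (hf : ContDiff ℝ ∞ f) (hfpos : ∀ t, 0 < f t) (hh : ContDiff ℝ ∞ h) :
    (∀ ρ : ℝ → ℝ, ContDiff ℝ ∞ ρ →
      (IsGradientRicciAlmostSoliton
          (warpedMetric (conformalPseudoEuclidean ε (ofXi α φ)) (ofXi α f) gF)
          (fun p => ofXi α h p.1) (fun p => ofXi α ρ p.1) ↔
        SolitonSystem n m (∑ i, ε i * α i ^ 2) lamF φ f h ρ)) ∧
    ((∃ ρ : EuclideanSpace ℝ (Fin n) × F → ℝ,
        IsGradientRicciAlmostSoliton
          (warpedMetric (conformalPseudoEuclidean ε (ofXi α φ)) (ofXi α f) gF)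
          (fun p => ofXi α h p.1) ρ) ↔
      ∃ ρ : ℝ → ℝ, ContDiff ℝ ∞ ρ ∧
        SolitonSystem n m (∑ i, ε i * α i ^ 2) lamF φ f h ρ) := by
  have hf0 : ∀ t, f t ≠ 0 := fun t => (hfpos t).ne'
  have hsmooth : ∀ u : ℝ → ℝ, ContDiff ℝ ∞ u → ContMDiff ((𝓡 n).prod (𝓡 m)) 𝓘(ℝ, ℝ) ∞
      (fun p : EuclideanSpace ℝ (Fin n) × F => ofXi α u p.1) := by
    intro u hu
    rw [ofXi_eq]
    exact (hu.comp (xiFunctional α).contDiff).contMDiff.comp contMDiff_fst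
  have key : ∀ ρ : ℝ → ℝ, ContDiff ℝ ∞ ρ →
      (IsGradientRicciAlmostSoliton
          (warpedMetric (conformalPseudoEuclidean ε (ofXi α φ)) (ofXi α f) gF)
          (fun p => ofXi α h p.1) (fun p => ofXi α ρ p.1) ↔
        SolitonSystem n m (∑ i, ε i * α i ^ 2) lamF φ f h ρ) := by
    intro ρ hρ
    constructor
    · intro hsol t
      obtain ⟨x, rfl⟩ := exists_xiFunctional_eq hα t
      obtain ⟨y⟩ := ‹Nonempty F›
      have h1 := (soliton_eq_iff_system hn hm hε hF hα hφ hφ0 hf hf0 hh (x, y) rfl _).1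
        (hsol.soliton_eq (x, y))
      rwa [ofXi_eq] at h1
    · intro hsys
      refine ⟨isSemiRiemannianMetric_warpedMetric hε hF.isSemiRiemannianMetric α hφ hφ0 hf hf0,
        hsmooth h hh, hsmooth ρ hρ, fun x => ?_⟩
      refine (soliton_eq_iff_system hn hm hε hF hα hφ hφ0 hf hf0 hh x rfl _).2 ?_
      rw [ofXi_eq]
      exact hsys _
  refine ⟨key, ?_, fun ⟨ρ, hρ, hsys⟩ => ⟨_, (key ρ hρ).2 hsys⟩⟩
  rintro ⟨σ, hsol⟩
  have hφ1 : ContDiff ℝ ∞ (deriv φ) := (contDiff_infty_iff_deriv.1 hφ).2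
  have hφ2 : ContDiff ℝ ∞ (deriv (deriv φ)) := (contDiff_infty_iff_deriv.1 hφ1).2
  have hf1 : ContDiff ℝ ∞ (deriv f) := (contDiff_infty_iff_deriv.1 hf).2
  have hh1 : ContDiff ℝ ∞ (deriv h) := (contDiff_infty_iff_deriv.1 hh).2
  -- The witness is the second equation solved for ρ; it is smooth because `f` has no zeros.
  refine ⟨fun t => (∑ i, ε i * α i ^ 2) * (f t * φ t * deriv (deriv φ) t
    - ((n : ℝ) - 1) * f t * (deriv φ t) ^ 2
    + m * φ t * deriv φ t * deriv f t - f t * φ t * deriv φ t * deriv h t) / f t,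
    ContDiff.div (by fun_prop) hf hf0, fun t => ?_⟩
  obtain ⟨x, rfl⟩ := exists_xiFunctional_eq hα t
  obtain ⟨y⟩ := ‹Nonempty F›
  have h1 := (soliton_eq_iff_system hn hm hε hF hα hφ hφ0 hf hf0 hh (x, y) rfl _).1
    (hsol.soliton_eq (x, y))
  -- The second equation at `(x, y)` forces the value of `σ` there to be that of the witness at
  -- ξ(x), so `σ` can be replaced in all three equations.
  have hσ := eq_div_of_mul_eq (hf0 _) h1.2.1.symm
  rw [hσ] at h1
  exact h1
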